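/- Theorem 4.2. Let $\Theta$ and $X$ be Borel subsets of Polish metric spaces. For a separable metric space $S$, let $\mathcal M(S)$ be the space of Borel probability measures on $S$, equipped with the weak topology and the Prokhorov metric $d_{Pr}$, let $\mathcal M^2(\Theta)=\mathcal M(\mathcal M(\Theta))$, and let $d_{tv}(\mu,\nu)=\sup_A|\mu(A)-\nu(A)|$ be the total variation metric. Let $P:\Theta\to\mathcal M(X)$ be an injective measurable model, dominated by a $\sigma$-finite measure, such that $P:\Theta\to P(\Theta)$ is open. For every prior $\pi\in\mathcal M(\Theta)$ and every $n$, fix a determination of the posteriors $x^n\mapsto\pi_{x^n}\in\mathcal M(\Theta)$, $x^n\in X^n$: a regular conditional distribution of $\theta$ given $x^n$ when $\theta\sim\pi$ and $x^n\sim P_\theta^n$ given $\theta$, where each $\pi_{x^n}$, $x^n\in X^n$, has a density with respect to the prior $\pi$ (as in Bayes' rule for densities). Let $\pi_*\mu^n\in\mathcal M^2(\Theta)$ be the law of $\pi_{x^n}$ when $x^n\sim\mu^n$, and let $\pi_n:X^\infty\to\mathcal M(\Theta)$, $\pi_n(x^\infty)=\pi_{x^n}$ with $x^n$ the first $n$ terms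 of $x^\infty$. For $\mu\in\mathcal M(X)$ let $$\alpha_\mu(Z,W)=\inf\{\epsilon\ge 0:\ \mu^\infty(d_{Pr}(Z,W)>\epsilon)\le\epsilon\}$$ be the Ky Fan metric on $\mathcal M(\Theta)$-valued random variables on $(X^\infty,\mu^\infty)$. Let $d_{\mathcal M(X)}$ and $d_{\mathcal M^2(\Theta)}$ be arbitrary pseudometrics on $\mathcal M(X)$ and $\mathcal M^2(\Theta)$. Given $\mathcal Z\subset(\mathcal M(\Theta)\times\mathcal M(X))^2$, Bayesian inference is called qualitatively robust with respect to $\mathcal Z$ if for all $\epsilon_1,\epsilon_2>0$ there are $\delta_1,\delta_2>0$ such that for every $((\pi,\mu),(\acute\pi,\acute\mu))\in\mathcal Z$ with $d_{tv}(\pi,\acute\pi)<\delta_1$ and $d_{\mathcal M(X)}(\mu,\acute\mu)<\delta_2$ one has $$d_{\mathcal M^2(\Theta)}(\acute\pi_*\mu^n,\acute\pi_*\acute\mu^n)<\epsilon_1\quad\text{and}\quad \alpha_\mu(\pi_n,\acute\pi_n)<\epsilon_2\quad\text{for all large enough } n .$$ Suppose that $\Theta$ is not totally bounded and that the prior $\pi\in\mathcal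 M(\Theta)$ has Kullback–Leibler support at every $\theta\in\Theta$, that is, $\pi\{\theta'\in\Theta: K(P_\theta,P_{\theta'})\le\epsilon\}>0$ for all $\theta\in\Theta$ and $\epsilon>0$, where $K(\mu_1,\mu_2)$ is the Kullback–Leibler divergence ($\int\log\frac{d\mu_1}{d\mu_2}\,d\mu_1$ if $\mu_1\ll\mu_2$, and $+\infty$ otherwise). Then for every $\rho>0$ Bayesian inference is not qualitatively robust with respect to $$\mathcal Z_\rho(\pi)=\{((\pi,P_\theta),(\acute\pi,P_\theta)):\ \acute\pi\in\mathcal M(\Theta),\ d_{tv}(\pi,\acute\pi)<\rho,\ \theta\in\Theta\}.$$ -/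

import Mathlib

open MeasureTheory Filter Topology
open scoped ENNReal

namespace BayesRobust

section Metrics

variable {S : Type*}

/-- A pseudometric on `S`, as a bare function (nonnegativity follows). -/
structure IsPseudometric (d : S → S → ℝ) : Prop where
  self : ∀ x, d x x = 0
  symm : ∀ x y, d x y = d y x
  triangle : ∀ x y z, d x z ≤ d x y + d y z

variable [MeasurableSpace S]

/-- Total variation distance `sup_A |μ(A) - ν(A)|` over measurable `A`. -/
noncomputable def tvDist (μ ν : ProbabilityMeasure S) : ℝ :=
  ⨆ A : {A : Set S // MeasurableSet A}, |(μ : Measure S).real A - (ν : Measure S).real A|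

/-- Prokhorov distance of probability measures. -/
noncomputable def prokhorovDist [PseudoEMetricSpace S] (μ ν : ProbabilityMeasure S) : ℝ :=
  levyProkhorovDist (μ : Measure S) (ν : Measure S)

end Metrics

section Sampling

variable {X : Type*} [MeasurableSpace X]

/-- The law `μⁿ` of `n` i.i.d. samples, a probability measure on `Xⁿ`. -/
noncomputable def sampleLaw (μ : ProbabilityMeasure X) (n : ℕ) :
    ProbabilityMeasure (Fin n → X) :=
  ⟨Measure.pi fun _ => (μ : Measure X), inferInstance⟩

/-- The law `μ^∞` of an i.i.d. sequence, a probability measure on `X^∞`. -/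
noncomputable def seqLaw (μ : ProbabilityMeasure X) : ProbabilityMeasure (ℕ → X) :=
  ⟨Measure.infinitePi fun _ => (μ : Measure X), inferInstance⟩

/-- The Ky Fan distance, under `μ^∞`, of two `M(S)`-valued random variables on `X^∞`,
where `M(S)` carries the Prokhorov metric. -/
noncomputable def kyFanDist {S : Type*} [MeasurableSpace S] [PseudoEMetricSpace S]
    (μ : ProbabilityMeasure X) (Z W : (ℕ → X) → ProbabilityMeasure S) : ℝ :=
  sInf {ε : ℝ | 0 ≤ ε ∧
    (seqLaw μ : Measure (ℕ → X)) {ω | ε < prokhorovDist (Z ω) (W ω)} ≤ ENNReal.ofReal ε}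

end Sampling

section Model

variable {Θ X : Type*} [MeasurableSpace Θ] [MeasurableSpace X]

/-- The model is dominated by a σ-finite measure. -/
def IsDominated (P : Θ → ProbabilityMeasure X) : Prop :=
  ∃ ν : Measure X, SigmaFinite ν ∧ ∀ θ, (P θ : Measure X) ≪ ν

/-- The Kullback–Leibler neighborhood `{θ' : K(P_θ, P_θ') ≤ ε}`. -/
def klNeighborhood (P : Θ → ProbabilityMeasure X) (θ : Θ) (ε : ℝ) : Set Θ :=
  {θ' | InformationTheory.klDiv (P θ : Measure X) (P θ' : Measure X) ≤ ENNReal.ofReal ε}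

/-- The prior `π` has Kullback–Leibler support at `θ`. -/
def HasKLSupportAt (P : Θ → ProbabilityMeasure X) (π : ProbabilityMeasure Θ) (θ : Θ) : Prop :=
  ∀ ε : ℝ, 0 < ε → 0 < (π : Measure Θ) (klNeighborhood P θ ε)

/-- The marginal law of the data `xⁿ` when `θ ∼ π` and `xⁿ ∼ P_θⁿ` given `θ`. -/
noncomputable def dataMarginal (P : Θ → ProbabilityMeasure X) (π : ProbabilityMeasure Θ)
    (n : ℕ) : Measure (Fin n → X) :=
  (π : Measure Θ).bind fun θ => (sampleLaw (P θ) n : Measure (Fin n → X))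

/-- `post` is a determination `xⁿ ↦ π_{xⁿ}` of the posteriors of `π` given `n` samples: a
regular conditional law of `θ` given `xⁿ` under the joint law of `(θ, xⁿ)`, each value of which
is given by a density with respect to the prior (as in Bayes' rule for densities). -/
structure IsPosterior (P : Θ → ProbabilityMeasure X) (π : ProbabilityMeasure Θ) (n : ℕ)
    (post : (Fin n → X) → ProbabilityMeasure Θ) : Prop where
  measurable : Measurable post
  disintegration : ∀ (A : Set (Fin n → X)) (B : Set Θ), MeasurableSet A → MeasurableSet B →
    ∫⁻ x in A, (post x : Measure Θ) B ∂(dataMarginal P π n) =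
      ∫⁻ θ in B, (sampleLaw (P θ) n : Measure (Fin n → X)) A ∂(π : Measure Θ)
  absolutelyContinuous : ∀ x, (post x : Measure Θ) ≪ (π : Measure Θ)

/-- Bayesian inference for the model `P`: a determination of the posteriors for every prior
and every sample size. -/
structure BayesianInference (P : Θ → ProbabilityMeasure X) where
  post : ProbabilityMeasure Θ → ∀ n : ℕ, (Fin n → X) → ProbabilityMeasure Θ
  isPosterior : ∀ π n, IsPosterior P π n (post π n)

variable {P : Θ → ProbabilityMeasure X}

/-- `π_* μⁿ`: the law on `M(Θ)` of the posterior `π_{xⁿ}` when `xⁿ ∼ μⁿ`. -/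
noncomputable def BayesianInference.posteriorLaw (I : BayesianInference P)
    (π : ProbabilityMeasure Θ) (n : ℕ) (μ : ProbabilityMeasure X) :
    ProbabilityMeasure (ProbabilityMeasure Θ) :=
  (sampleLaw μ n).map (I.isPosterior π n).measurable.aemeasurable

/-- `π_n : X^∞ → M(Θ)`, the posterior after the first `n` terms of a sequence of data. -/
def BayesianInference.posteriorSeq (I : BayesianInference P) (π : ProbabilityMeasure Θ) (n : ℕ) :
    (ℕ → X) → ProbabilityMeasure Θ :=
  fun ω => I.post π n fun i => ω i

/-- Qualitative robustness with respect to a set `Z` of admissible pairs `((π, μ), (π', μ'))` and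
perturbation pseudometrics on `M(Θ)`, `M(X)`, `M(M(Θ))` and on `M(Θ)`-valued random variables on
`(X^∞, μ^∞)`. -/
def QualitativelyRobust (I : BayesianInference P)
    (dΘ : ProbabilityMeasure Θ → ProbabilityMeasure Θ → ℝ)
    (dX : ProbabilityMeasure X → ProbabilityMeasure X → ℝ)
    (dM : ProbabilityMeasure (ProbabilityMeasure Θ) →
      ProbabilityMeasure (ProbabilityMeasure Θ) → ℝ)
    (α : ProbabilityMeasure X →
      ((ℕ → X) → ProbabilityMeasure Θ) → ((ℕ → X) → ProbabilityMeasure Θ) → ℝ)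
    (Z : Set ((ProbabilityMeasure Θ × ProbabilityMeasure X) ×
      (ProbabilityMeasure Θ × ProbabilityMeasure X))) : Prop :=
  ∀ ε₁ > 0, ∀ ε₂ > 0, ∃ δ₁ > 0, ∃ δ₂ > 0,
    ∀ (π : ProbabilityMeasure Θ) (μ : ProbabilityMeasure X)
      (π' : ProbabilityMeasure Θ) (μ' : ProbabilityMeasure X),
      ((π, μ), (π', μ')) ∈ Z → dΘ π π' < δ₁ → dX μ μ' < δ₂ →
        ∀ᶠ n in atTop,
          dM (I.posteriorLaw π' n μ) (I.posteriorLaw π' n μ') < ε₁ ∧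
          α μ (I.posteriorSeq π n) (I.posteriorSeq π' n) < ε₂

/-- `Z_ρ(π) = {π} × B^{tv}_ρ(π) × {(P_θ, P_θ) : θ ∈ Θ}`, rearranged into pairs
`((π, P_θ), (π', P_θ))`. -/
def admissibleSet (P : Θ → ProbabilityMeasure X) (π : ProbabilityMeasure Θ) (ρ : ℝ) :
    Set ((ProbabilityMeasure Θ × ProbabilityMeasure X) ×
      (ProbabilityMeasure Θ × ProbabilityMeasure X)) :=
  {z | z.1.1 = π ∧ tvDist π z.2.1 < ρ ∧ ∃ θ, z.1.2 = P θ ∧ z.2.2 = P θ}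

end Model

end BayesRobust

/-! Since `Θ` is not totally bounded, it contains infinitely many disjoint balls of one radius `r`,
so some have arbitrarily small prior mass. Conditioning `π` on the complement of such a ball gives a
prior `π'` arbitrarily close to `π` in total variation. Its posteriors never charge the ball, while
for data from the center `θ₀` those of `π` concentrate there. The Ky Fan distance thus stays above a
constant depending only on `r`, which was fixed before the tolerances.

Concentration is Schwartz's theorem. Openness and injectivity make a ball the preimage of a weakly
open set, which Hoeffding's inequality lets one test with exponential power
(`isExpTestable_of_mem_nhds`). In place of a law of large numbers for likelihood ratios, a change of
measure bound (`mul_exp_le_measureReal_of_klDiv_le`) shows that an event likely under `θ₀` has prior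
predictive mass decaying more slowly than the test errors. -/

namespace BayesRobust

/-! ### Kullback–Leibler divergence and change of measure -/

section KullbackLeibler

open InformationTheory ProbabilityTheory

variable {α β : Type*} [MeasurableSpace α] [MeasurableSpace β]

/-- The divergence is the `ν`-integral of the nonnegative function `klFun` of the density, and
restriction to `A` does not change the density on `A`. -/
lemma klDiv_restrict_le (μ ν : Measure α) [IsFiniteMeasure μ] [IsFiniteMeasure ν]
    {A : Set α} (hA : MeasurableSet A) :
    klDiv (μ.restrict A) (ν.restrict A) ≤ klDiv μ ν := by
  by_cases hμν : μ ≪ ν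
  swap; · simp [klDiv_of_not_ac hμν]
  have hd : (μ.restrict A).rnDeriv (ν.restrict A) =ᵐ[ν.restrict A] μ.rnDeriv ν := by
    have h : μ.restrict A = (ν.restrict A).withDensity (μ.rnDeriv ν) := by
      rw [← restrict_withDensity hA, Measure.withDensity_rnDeriv_eq μ ν hμν]
    rw [h]
    exact Measure.rnDeriv_withDensity _ (Measure.measurable_rnDeriv μ ν)
  rw [klDiv_eq_lintegral_klFun_of_ac hμν, klDiv_eq_lintegral_klFun_of_ac (hμν.restrict A)]
  calc
    _ = ∫⁻ x in A, ENNReal.ofReal (klFun (μ.rnDeriv ν x).toReal) ∂ν := by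
      refine lintegral_congr_ae ?_
      filter_upwards [hd] with x hx using by rw [hx]
    _ ≤ _ := setLIntegral_le_lintegral _ _

/-- Chain rule for constant kernels; swapping the factors of the second term lets the common factor
`μ` cancel. -/
lemma klDiv_prod_le (μ ν : Measure α) (κ η : Measure β) [IsProbabilityMeasure μ]
    [IsProbabilityMeasure ν] [IsProbabilityMeasure κ] [IsProbabilityMeasure η] :
    klDiv (μ.prod κ) (ν.prod η) ≤ klDiv μ ν + klDiv κ η := by
  rw [← Measure.compProd_const, ← Measure.compProd_const, klDiv_compProd_eq_add,
    Measure.compProd_const, Measure.compProd_const]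
  gcongr
  calc
    klDiv (μ.prod κ) (μ.prod η)
        = klDiv ((κ.prod μ).map Prod.swap) ((η.prod μ).map Prod.swap) := by
      rw [Measure.prod_swap, Measure.prod_swap]
    _ ≤ klDiv (κ.prod μ) (η.prod μ) := klDiv_map_le _ _ measurable_swap
    _ = klDiv κ η := by
      rw [← Measure.compProd_const, ← Measure.compProd_const, klDiv_compProd_left]

lemma klDiv_pi_le (μ ν : Measure α) [IsProbabilityMeasure μ] [IsProbabilityMeasure ν] (n : ℕ) :
    klDiv (Measure.pi fun _ : Fin n => μ) (Measure.pi fun _ : Fin n => ν) ≤ n * klDiv μ ν := by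
  induction n with
  | zero =>
    rw [Measure.pi_of_empty, Measure.pi_of_empty, klDiv_self]
    simp
  | succ n ih =>
    have h (ξ : Measure α) [IsProbabilityMeasure ξ] :
        (Measure.pi fun _ : Fin (n + 1) => ξ) =
          (ξ.prod (Measure.pi fun _ : Fin n => ξ)).map
            (MeasurableEquiv.piFinSuccAbove (fun _ => α) 0).symm :=
      ((measurePreserving_piFinSuccAbove (fun _ : Fin (n + 1) => ξ) 0).symm _).map_eq.symm
    rw [h μ, h ν]
    refine (klDiv_map_le _ _ (MeasurableEquiv.measurable _)).trans ((klDiv_prod_le _ _ _ _).trans ?_)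
    push_cast
    rw [add_mul, one_mul, add_comm]
    gcongr

/-- The log-sum inequality on `A` bounds `μ(A) log (μ(A)/ν(A)) + ν(A) - μ(A)` by `c`; the `+ 1`
absorbs `μ(A) ≤ 1`. -/
lemma mul_exp_le_measureReal_of_klDiv_le (μ ν : Measure α) [IsProbabilityMeasure μ]
    [IsProbabilityMeasure ν] {A : Set α} (hA : MeasurableSet A) {c p : ℝ} (hc : 0 ≤ c)
    (hp : 0 < p) (hpA : p ≤ μ.real A) (h : klDiv μ ν ≤ ENNReal.ofReal c) :
    p * Real.exp (-((c + 1) / p)) ≤ ν.real A := by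
  have hμν : μ ≪ ν := (klDiv_ne_top_iff.1 (h.trans_lt ENNReal.ofReal_lt_top).ne).1
  have hP : 0 < μ.real A := hp.trans_le hpA
  have hQ : 0 < ν.real A := by
    refine measureReal_nonneg.lt_of_ne' fun h0 => hP.ne' ?_
    rw [measureReal_eq_zero_iff] at h0 ⊢
    exact hμν h0
  have hkl := ((mul_log_le_klDiv (μ.restrict A) (ν.restrict A)).trans
    (klDiv_restrict_le μ ν hA)).trans h
  rw [ENNReal.ofReal_le_ofReal_iff hc, measureReal_restrict_apply_univ,
    measureReal_restrict_apply_univ] at hkl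
  have hP1 : μ.real A ≤ 1 := measureReal_le_one
  have hlog : Real.log (μ.real A / ν.real A) ≤ (c + 1) / p :=
    calc
      _ ≤ (c + 1) / μ.real A := by
        rw [le_div_iff₀ hP]
        linarith
      _ ≤ _ := by gcongr
  rw [Real.log_le_iff_le_exp (div_pos hP hQ), div_le_iff₀ hQ] at hlog
  rw [Real.exp_neg, ← div_eq_mul_inv, div_le_iff₀ (Real.exp_pos _), mul_comm]
  exact hpA.trans hlog

end KullbackLeibler

/-! ### Exponentially powerful tests for weak neighborhoods -/

section Tests

open ProbabilityTheory

variable {X : Type*} [MeasurableSpace X]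

lemma hoeffding_sampleLaw (μ : ProbabilityMeasure X) {g : X → ℝ} (hg : Measurable g) {M η : ℝ}
    (hM : 0 < M) (hgM : ∀ x, |g x| ≤ M) (hη : 0 ≤ η) (n : ℕ) :
    (sampleLaw μ n : Measure (Fin n → X)).real
      {x | n * (∫ y, g y ∂(μ : Measure X) + η) ≤ ∑ i, g (x i)} ≤
        Real.exp (-(η ^ 2 / (2 * M ^ 2)) * n) := by
  set m := ∫ y, g y ∂(μ : Measure X)
  set c : NNReal := (‖M - -M‖₊ / 2) ^ 2 with hc
  have hcM : (c : ℝ) = M ^ 2 := by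
    simp only [hc, sub_neg_eq_add, NNReal.coe_pow, NNReal.coe_div, coe_nnnorm, NNReal.coe_ofNat,
      Real.norm_eq_abs]
    rw [abs_of_pos (by linarith)]
    ring
  have hsub : HasSubgaussianMGF (fun y => g y - m) c (μ : Measure X) :=
    hasSubgaussianMGF_of_mem_Icc hg.aemeasurable (ae_of_all _ fun x => abs_le.1 (hgM x))
  have hind : iIndepFun (fun (i : Fin n) (x : Fin n → X) => g (x i) - m)
      (Measure.pi fun _ => (μ : Measure X)) :=
    iIndepFun_pi (X := fun _ y => g y - m) fun _ => (hg.sub_const m).aemeasurable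
  have hsub' (i : Fin n) : HasSubgaussianMGF (fun x : Fin n → X => g (x i) - m) c
      (Measure.pi fun _ => (μ : Measure X)) := by
    refine HasSubgaussianMGF.of_map (Y := fun x : Fin n → X => x i) (X := fun y => g y - m)
      (measurable_pi_apply i).aemeasurable ?_
    rwa [(measurePreserving_eval (fun _ : Fin n => (μ : Measure X)) i).map_eq]
  have h := HasSubgaussianMGF.measure_sum_ge_le_of_iIndepFun hind (s := Finset.univ)
    (fun i _ => hsub' i) (ε := n * η) (by positivity)
  have hset : {x : Fin n → X | n * (m + η) ≤ ∑ i, g (x i)} =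
      {x | n * η ≤ ∑ i, (g (x i) - m)} := by
    ext x
    simp only [Set.mem_ofPred_eq, Finset.sum_sub_distrib, Finset.sum_const, Finset.card_univ,
      Fintype.card_fin, nsmul_eq_mul]
    constructor <;> intro h <;> linarith
  rw [hset]
  refine h.trans_eq ?_
  congr 1
  simp only [Finset.sum_const, Finset.card_univ, Fintype.card_fin, nsmul_eq_mul,
    hcM, NNReal.coe_mul, NNReal.coe_natCast]
  rcases Nat.eq_zero_or_pos n with rfl | hn
  · simp
  · field_simp

/-- `V` can be tested against `μ₀` with consistent, exponentially powerful tests: there are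
acceptance regions whose complements have vanishing probability under `μ₀`, and which are
exponentially unlikely, uniformly over laws outside `V`. -/
def IsExpTestable (μ₀ : ProbabilityMeasure X) (V : Set (ProbabilityMeasure X)) : Prop :=
  ∃ β > 0, ∃ C : ℝ, ∃ T : ∀ n : ℕ, Set (Fin n → X), (∀ n, MeasurableSet (T n)) ∧
    Tendsto (fun n => (sampleLaw μ₀ n : Measure (Fin n → X)).real (T n)ᶜ) atTop (𝓝 0) ∧
    ∀ μ ∉ V, ∀ n : ℕ,
      (sampleLaw μ n : Measure (Fin n → X)).real (T n) ≤ C * Real.exp (-β * n)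

lemma IsExpTestable.mono {μ₀ : ProbabilityMeasure X} {V W : Set (ProbabilityMeasure X)}
    (hV : IsExpTestable μ₀ V) (hVW : V ⊆ W) : IsExpTestable μ₀ W := by
  obtain ⟨β, hβ, C, T, hT, h0, h1⟩ := hV
  exact ⟨β, hβ, C, T, hT, h0, fun μ hμ => h1 μ fun h => hμ (hVW h)⟩

lemma IsExpTestable.univ (μ₀ : ProbabilityMeasure X) : IsExpTestable μ₀ Set.univ :=
  ⟨1, one_pos, 0, fun _ => Set.univ, fun _ => .univ, by simp, by simp⟩

lemma IsExpTestable.inter {μ₀ : ProbabilityMeasure X} {V W : Set (ProbabilityMeasure X)}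
    (hV : IsExpTestable μ₀ V) (hW : IsExpTestable μ₀ W) : IsExpTestable μ₀ (V ∩ W) := by
  obtain ⟨β, hβ, C, T, hT, hT0, hT1⟩ := hV
  obtain ⟨β', hβ', C', T', hT', hT0', hT1'⟩ := hW
  -- The constant must be nonnegative for the bound to survive lowering the rate to the minimum.
  refine ⟨min β β', lt_min hβ hβ', max C C' ⊔ 0, fun n => T n ∩ T' n,
    fun n => (hT n).inter (hT' n), ?_, fun μ hμ n => ?_⟩
  · refine squeeze_zero (fun n => measureReal_nonneg) (fun n => ?_)
      (by simpa using hT0.add hT0')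
    rw [Set.compl_inter]
    exact measureReal_union_le _ _
  · rw [Set.mem_inter_iff, not_and_or] at hμ
    rcases hμ with hμ | hμ
    · refine (measureReal_mono Set.inter_subset_left).trans ((hT1 μ hμ n).trans ?_)
      gcongr
      · exact (le_max_left _ _).trans (le_max_left _ _)
      · exact min_le_left _ _
    · refine (measureReal_mono Set.inter_subset_right).trans ((hT1' μ hμ n).trans ?_)
      gcongr
      · exact (le_max_right _ _).trans (le_max_left _ _)
      · exact min_le_right _ _

lemma isExpTestable_integral_lt (μ₀ : ProbabilityMeasure X) {g : X → ℝ} (hg : Measurable g)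
    {M : ℝ} (hM : 0 < M) (hgM : ∀ x, |g x| ≤ M) {a : ℝ}
    (ha : ∫ y, g y ∂(μ₀ : Measure X) < a) :
    IsExpTestable μ₀ {μ | ∫ y, g y ∂(μ : Measure X) < a} := by
  set m := ∫ y, g y ∂(μ₀ : Measure X) with hm
  -- The test compares the empirical mean of `g` with the midpoint of `m` and `a`. Hoeffding's rate
  -- depends only on `η` and `M`, so it is uniform in the alternatives.
  set η := (a - m) / 2 with hη
  have hη0 : 0 < η := by linarith
  set β := η ^ 2 / (2 * M ^ 2)
  have hβ : 0 < β := by positivity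
  refine ⟨β, hβ, 1, fun n => {x | ∑ i, g (x i) ≤ n * (m + η)}, fun n => ?_, ?_,
    fun μ hμ n => ?_⟩
  · exact measurableSet_le (Finset.measurable_fun_sum _ fun i _ => hg.comp (measurable_pi_apply i))
      measurable_const
  · refine squeeze_zero (fun n => measureReal_nonneg) (fun n => ?_)
      (g := fun n : ℕ => Real.exp (-β * n)) ?_
    · refine (measureReal_mono fun x hx => ?_).trans
        (hoeffding_sampleLaw μ₀ hg hM hgM hη0.le n)
      simp only [Set.mem_compl_iff, Set.mem_ofPred_eq, not_le] at hx ⊢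
      exact hx.le
    · refine Real.tendsto_exp_atBot.comp ?_
      exact tendsto_natCast_atTop_atTop.const_mul_atTop_of_neg (by linarith)
  · simp only [Set.mem_ofPred_eq, not_lt] at hμ
    rw [one_mul]
    refine (measureReal_mono fun x hx => ?_).trans
      (hoeffding_sampleLaw μ hg.neg hM (by simpa using hgM) hη0.le n)
    simp only [Set.mem_ofPred_eq, Pi.neg_apply, integral_neg, Finset.sum_neg_distrib] at hx ⊢
    have : (n : ℝ) * (m + η) ≤ n * (∫ y, g y ∂(μ : Measure X) - η) := by
      gcongr
      linarith
    linarith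

variable [TopologicalSpace X] [OpensMeasurableSpace X]

/-- Testable sets form a filter. That it is finer than `𝓝 μ₀` need only be checked on integrals of
bounded continuous functions, hence on half-lines. -/
lemma isExpTestable_of_mem_nhds {μ₀ : ProbabilityMeasure X} {V : Set (ProbabilityMeasure X)}
    (hV : V ∈ 𝓝 μ₀) : IsExpTestable μ₀ V := by
  let 𝓕 : Filter (ProbabilityMeasure X) :=
    { sets := {V | IsExpTestable μ₀ V}
      univ_sets := .univ μ₀
      sets_of_superset := fun h => h.mono
      inter_sets := .inter }
  have h : Tendsto id 𝓕 (𝓝 μ₀) := by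
    refine ProbabilityMeasure.tendsto_iff_forall_integral_tendsto.2 fun f => ?_
    have hM : 0 < ‖f‖ + 1 := by positivity
    have hf (x : X) : |f x| ≤ ‖f‖ + 1 := (f.norm_coe_le_norm x).trans (by linarith)
    refine tendsto_order.2 ⟨fun a ha => ?_, fun a ha => ?_⟩
    · have := isExpTestable_integral_lt μ₀ f.continuous.measurable.neg hM (by simpa using hf)
        (a := -a) (by simpa [integral_neg] using ha)
      simp only [Pi.neg_apply, integral_neg, neg_lt_neg_iff] at this
      exact this
    · exact isExpTestable_integral_lt μ₀ f.continuous.measurable hM hf ha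
  exact h hV

end Tests

/-! ### Schwartz's consistency theorem -/

section Consistency

variable {Θ X : Type*} [MeasurableSpace Θ] [MeasurableSpace X]

lemma measurable_sampleLaw_apply {P : Θ → ProbabilityMeasure X} (hP : Measurable P) (n : ℕ)
    {A : Set (Fin n → X)} (hA : MeasurableSet A) :
    Measurable fun θ => (sampleLaw (P θ) n : Measure (Fin n → X)) A := by
  have h : Measurable fun θ => (sampleLaw (P θ) n : Measure (Fin n → X)) := by
    refine Measurable.measure_of_isPiSystem_of_isProbabilityMeasure
      (generateFrom_pi (α := fun _ : Fin n => X)).symm isPiSystem_pi ?_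
    rintro _ ⟨s, hs, rfl⟩
    have hs' (i : Fin n) : MeasurableSet (s i) := hs i (Set.mem_univ i)
    simp only [sampleLaw, ProbabilityMeasure.coe_mk, Measure.pi_pi]
    exact Finset.measurable_fun_prod _ fun i _ =>
      (Measure.measurable_coe (hs' i)).comp (measurable_subtype_coe.comp hP)
  exact (Measure.measurable_coe hA).comp h

namespace IsPosterior

variable {P : Θ → ProbabilityMeasure X} {π : ProbabilityMeasure Θ} {n : ℕ}
  {post : (Fin n → X) → ProbabilityMeasure Θ}

lemma measurable_real (h : IsPosterior P π n post) {B : Set Θ} (hB : MeasurableSet B) :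
    Measurable fun x => (post x : Measure Θ).real B :=
  ((Measure.measurable_coe hB).comp (measurable_subtype_coe.comp h.measurable)).ennreal_toReal

lemma dataMarginal_apply (h : IsPosterior P π n post) {A : Set (Fin n → X)}
    (hA : MeasurableSet A) :
    dataMarginal P π n A =
      ∫⁻ θ, (sampleLaw (P θ) n : Measure (Fin n → X)) A ∂(π : Measure Θ) := by
  simpa using h.disintegration A Set.univ hA .univ

/-- If the posterior mass of `B` is at least `c` on `A`, the prior predictive mass of `A` is
controlled by the laws of the data for parameters in `B`. -/
lemma mul_dataMarginal_le (h : IsPosterior P π n post) {A : Set (Fin n → X)}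
    (hA : MeasurableSet A) {B : Set Θ} (hB : MeasurableSet B) {c D : ℝ}
    (hAB : ∀ x ∈ A, c ≤ (post x : Measure Θ).real B)
    (hD : ∀ θ ∈ B, (sampleLaw (P θ) n : Measure (Fin n → X)).real A ≤ D) :
    ENNReal.ofReal c * dataMarginal P π n A ≤ ENNReal.ofReal D := by
  calc
    ENNReal.ofReal c * dataMarginal P π n A
        = ∫⁻ _ in A, ENNReal.ofReal c ∂(dataMarginal P π n) := (setLIntegral_const _ _).symm
    _ ≤ ∫⁻ x in A, (post x : Measure Θ) B ∂(dataMarginal P π n) := by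
      refine setLIntegral_mono' hA fun x hx => ?_
      rw [← ofReal_measureReal]
      exact ENNReal.ofReal_le_ofReal (hAB x hx)
    _ = ∫⁻ θ in B, (sampleLaw (P θ) n : Measure (Fin n → X)) A ∂(π : Measure Θ) :=
      h.disintegration A B hA hB
    _ ≤ ∫⁻ _ in B, ENNReal.ofReal D ∂(π : Measure Θ) := by
      refine setLIntegral_mono' hB fun θ hθ => ?_
      rw [← ofReal_measureReal]
      exact ENNReal.ofReal_le_ofReal (hD θ hθ)
    _ ≤ ENNReal.ofReal D := by
      rw [setLIntegral_const]
      exact mul_le_of_le_one_right' prob_le_one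

end IsPosterior

/-- A lower bound on the prior predictive mass of an event which is likely under `P θ₀`, in terms
of the prior mass of a Kullback–Leibler neighborhood of `θ₀`. -/
lemma mul_klNeighborhood_le_lintegral {P : Θ → ProbabilityMeasure X} (hP : Measurable P)
    (π : ProbabilityMeasure Θ) (θ₀ : Θ) {n : ℕ} {A : Set (Fin n → X)} (hA : MeasurableSet A)
    {ε p : ℝ} (hε : 0 ≤ ε) (hp : 0 < p)
    (hpA : p ≤ (sampleLaw (P θ₀) n : Measure (Fin n → X)).real A) :
    ENNReal.ofReal (p * Real.exp (-((n * ε + 1) / p))) *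
        (π : Measure Θ) (klNeighborhood P θ₀ ε) ≤
      ∫⁻ θ, (sampleLaw (P θ) n : Measure (Fin n → X)) A ∂(π : Measure Θ) := by
  refine le_trans ?_ (mul_meas_ge_le_lintegral (measurable_sampleLaw_apply hP n hA)
    (ENNReal.ofReal (p * Real.exp (-((n * ε + 1) / p)))))
  gcongr
  intro θ hθ
  have hkl : InformationTheory.klDiv (sampleLaw (P θ₀) n : Measure (Fin n → X))
      (sampleLaw (P θ) n : Measure (Fin n → X)) ≤ ENNReal.ofReal (n * ε) := by
    refine (klDiv_pi_le _ _ n).trans ?_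
    rw [ENNReal.ofReal_mul (by positivity), ENNReal.ofReal_natCast]
    gcongr
    exact hθ
  have := mul_exp_le_measureReal_of_klDiv_le _ _ hA (by positivity) hp hpA hkl
  rw [Set.mem_ofPred_eq, ← ofReal_measureReal]
  exact ENNReal.ofReal_le_ofReal this

/-- **Schwartz's theorem**, in probability: under a Kullback–Leibler condition on the prior, the
posterior mass of the complement of a testable set of parameters vanishes asymptotically. -/
theorem tendsto_sampleLaw_posterior_ge {P : Θ → ProbabilityMeasure X} (hP : Measurable P)
    {π : ProbabilityMeasure Θ} {post : ∀ n : ℕ, (Fin n → X) → ProbabilityMeasure Θ}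
    (hpost : ∀ n, IsPosterior P π n (post n)) {θ₀ : Θ} (hπ : HasKLSupportAt P π θ₀)
    {V : Set (ProbabilityMeasure X)} (hV : IsExpTestable (P θ₀) V) {B : Set Θ}
    (hB : MeasurableSet B) (hBV : ∀ θ ∈ B, P θ ∉ V) {c : ℝ} (hc : 0 < c) :
    Tendsto (fun n => (sampleLaw (P θ₀) n : Measure (Fin n → X)).real
      {x | c ≤ (post n x : Measure Θ).real B}) atTop (𝓝 0) := by
  obtain ⟨β, hβ, C, T, hT, hT0, hT1⟩ := hV
  let A (n : ℕ) : Set (Fin n → X) := {x | c ≤ (post n x : Measure Θ).real B}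
  have hA (n : ℕ) : MeasurableSet (A n) :=
    measurableSet_le measurable_const ((hpost n).measurable_real hB)
  have key : Tendsto (fun n => (sampleLaw (P θ₀) n : Measure (Fin n → X)).real (A n ∩ T n))
      atTop (𝓝 0) := by
    refine tendsto_order.2 ⟨fun a ha => Eventually.of_forall fun n =>
      ha.trans_le measureReal_nonneg, fun p hp => ?_⟩
    -- With this `ε` the change of measure costs a factor `exp (-nε/p) = exp (-βn/2)`, half the rate
    -- of the test.
    set ε := β * p / 2 with hε
    have hε0 : 0 < ε := by positivity
    have hK0 := hπ ε hε0
    set K : ℝ := (π : Measure Θ).real (klNeighborhood P θ₀ ε) with hK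
    have hKpos : 0 < K := ENNReal.toReal_pos hK0.ne' (measure_ne_top _ _)
    have hlim : Tendsto (fun n : ℕ => C * Real.exp (-(β / 2) * n)) atTop (𝓝 (C * 0)) := by
      refine (Real.tendsto_exp_atBot.comp ?_).const_mul C
      exact tendsto_natCast_atTop_atTop.const_mul_atTop_of_neg (by linarith)
    rw [mul_zero] at hlim
    filter_upwards [hlim.eventually (gt_mem_nhds
      (show (0 : ℝ) < c * (p * Real.exp (-(1 / p)) * K) by positivity))] with n hn
    by_contra! hpn
    have hAT := (hA n).inter (hT n)
    have h1 := mul_klNeighborhood_le_lintegral hP π θ₀ hAT hε0.le hp hpn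
    have h2 := (hpost n).mul_dataMarginal_le hAT hB (fun x hx => hx.1) (fun θ hθ =>
      (measureReal_mono Set.inter_subset_right).trans (hT1 (P θ) (hBV θ hθ) n))
    rw [(hpost n).dataMarginal_apply hAT] at h2
    have h3 := (mul_le_mul_right h1 (ENNReal.ofReal c)).trans h2
    rw [← ofReal_measureReal (μ := (π : Measure Θ)), ← hK, ← ENNReal.ofReal_mul (by positivity),
      ← ENNReal.ofReal_mul hc.le] at h3
    have h4 : c * (p * Real.exp (-((n * ε + 1) / p)) * K) ≤ C * Real.exp (-β * n) := by
      by_contra! hlt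
      exact absurd h3 (not_le.2 (ENNReal.ofReal_lt_ofReal_iff (by positivity) |>.2 hlt))
    have e1 : Real.exp (-((n * ε + 1) / p)) = Real.exp (-(1 / p)) * Real.exp (-(β / 2) * n) := by
      rw [← Real.exp_add]
      congr 1
      rw [hε]
      field_simp
      ring
    have e2 : Real.exp (-β * n) = Real.exp (-(β / 2) * n) * Real.exp (-(β / 2) * n) := by
      rw [← Real.exp_add]
      congr 1
      ring
    rw [e1, e2] at h4
    have h5 : (c * (p * Real.exp (-(1 / p)) * K)) * Real.exp (-(β / 2) * n) ≤
        (C * Real.exp (-(β / 2) * n)) * Real.exp (-(β / 2) * n) := by linarith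
    exact absurd (le_of_mul_le_mul_right h5 (Real.exp_pos _)) (not_le.2 hn)
  refine squeeze_zero (fun n => measureReal_nonneg) (fun n => ?_) (by simpa using key.add hT0)
  refine (measureReal_mono (s₂ := A n ∩ T n ∪ (T n)ᶜ) fun x hx => ?_).trans
    (measureReal_union_le _ _)
  by_cases hxT : x ∈ T n
  · exact Or.inl ⟨hx, hxT⟩
  · exact Or.inr hxT

end Consistency

/-! ### Finite marginals of the i.i.d. sequence -/

section SampleSequences

variable {X : Type*} [MeasurableSpace X]

lemma map_seqLaw (μ : ProbabilityMeasure X) (n : ℕ) :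
    (seqLaw μ : Measure (ℕ → X)).map (fun ω (i : Fin n) => ω i) = sampleLaw μ n := by
  have hmeas : Measurable fun (ω : ℕ → X) (i : Fin n) => ω i := by fun_prop
  refine (Measure.pi_eq fun s hs => ?_).symm
  let t (i : ℕ) : Set X := if h : i < n then s ⟨i, h⟩ else Set.univ
  have hpre : (fun (ω : ℕ → X) (i : Fin n) => ω i) ⁻¹' (Set.univ.pi s) =
      Set.pi (Finset.range n) t := by
    ext ω
    simp only [Set.mem_preimage, Set.mem_pi, Finset.coe_range, Set.mem_Iio, t]
    constructor
    · intro h i hi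
      simpa [hi] using h ⟨i, hi⟩
    · intro h i
      simpa using h i i.2
  rw [Measure.map_apply hmeas (.univ_pi hs), hpre]
  simp only [seqLaw, ProbabilityMeasure.coe_mk]
  rw [Measure.infinitePi_pi _ fun i hi => ?_]
  · rw [Finset.prod_range]
    exact Finset.prod_congr rfl fun i _ => by simp [t]
  · simp only [Finset.mem_range] at hi
    simpa [t, hi] using hs ⟨i, hi⟩

end SampleSequences

/-! ### Conditioning, Prokhorov and Ky Fan distances -/

section Perturbation

variable {S : Type*} [MeasurableSpace S]

/-- Conditioning on the complement of a set `B` of mass `< 1` moves a probability measure by at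
most the mass of `B` in total variation. -/
lemma exists_measure_eq_zero_tvDist_le (π : ProbabilityMeasure S) {B : Set S}
    (hB : MeasurableSet B) (hB1 : (π : Measure S).real B < 1) :
    ∃ π' : ProbabilityMeasure S, (π' : Measure S) B = 0 ∧
      tvDist π π' ≤ (π : Measure S).real B := by
  have hc : (π : Measure S).real Bᶜ = 1 - (π : Measure S).real B := probReal_compl_eq_one_sub hB
  have hc0 : (π : Measure S) Bᶜ ≠ 0 := fun h => by
    rw [measureReal_def, h, ENNReal.toReal_zero] at hc
    linarith
  refine ⟨⟨ProbabilityTheory.cond (π : Measure S) Bᶜ,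
    ProbabilityTheory.cond_isProbabilityMeasure hc0⟩, ?_, ?_⟩
  · simp [ProbabilityTheory.cond_apply hB.compl]
  · have : Nonempty {A : Set S // MeasurableSet A} := ⟨⟨∅, .empty⟩⟩
    refine ciSup_le fun A => ?_
    simp only [ProbabilityMeasure.coe_mk]
    rw [measureReal_def (ProbabilityTheory.cond _ _), ProbabilityTheory.cond_apply hB.compl,
      ENNReal.toReal_mul, ENNReal.toReal_inv, ← measureReal_def, ← measureReal_def, hc]
    set q := (π : Measure S).real B
    have h1 : (π : Measure S).real (Bᶜ ∩ A) ≤ 1 - q :=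
      hc ▸ measureReal_mono Set.inter_subset_left
    have h2 : (π : Measure S).real (Bᶜ ∩ A) ≤ (π : Measure S).real A :=
      measureReal_mono Set.inter_subset_right
    have h3 : (π : Measure S).real A ≤ (π : Measure S).real (Bᶜ ∩ A) + q := by
      refine (measureReal_mono fun x hx => ?_).trans (measureReal_union_le _ _)
      by_cases hxB : x ∈ B
      · exact Or.inr hxB
      · exact Or.inl ⟨hxB, hx⟩
    have hq : 0 ≤ q := measureReal_nonneg
    set s := (π : Measure S).real (Bᶜ ∩ A)
    have hs0 : 0 ≤ s := measureReal_nonneg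
    have hq1 : 0 < 1 - q := by linarith
    have h4 : s ≤ (1 - q)⁻¹ * s := by
      refine le_mul_of_one_le_left hs0 ((one_le_inv₀ hq1).2 (by linarith))
    -- Equivalent to `0 ≤ q (1 - q - s)`, which is `h1` times `q`.
    have h5 : (1 - q)⁻¹ * s ≤ s + q := by
      rw [inv_mul_le_iff₀ hq1]
      nlinarith
    rw [abs_le]
    constructor <;> linarith

variable [PseudoEMetricSpace S]

lemma measureReal_le_of_prokhorovDist_lt {μ ν : ProbabilityMeasure S} {ε : ℝ}
    (h : prokhorovDist μ ν < ε) {B : Set S} (hB : MeasurableSet B) :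
    (μ : Measure S).real B ≤ (ν : Measure S).real (Metric.thickening ε B) + ε := by
  have hε : 0 ≤ ε := ENNReal.toReal_nonneg.trans h.le
  have h' : levyProkhorovEDist (μ : Measure S) (ν : Measure S) < ENNReal.ofReal ε :=
    (ENNReal.lt_ofReal_iff_toReal_lt (levyProkhorovEDist_ne_top _ _)).2 h
  have := left_measure_le_of_levyProkhorovEDist_lt h' hB
  rw [ENNReal.toReal_ofReal hε, ← ofReal_measureReal, ← ofReal_measureReal,
    ← ENNReal.ofReal_add measureReal_nonneg hε] at this
  exact (ENNReal.ofReal_le_ofReal_iff (by positivity)).1 this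

lemma seqLaw_le_of_kyFanDist_lt {X : Type*} [MeasurableSpace X] {μ : ProbabilityMeasure X}
    {Z W : (ℕ → X) → ProbabilityMeasure S} {ε : ℝ} (h : kyFanDist μ Z W < ε) :
    (seqLaw μ : Measure (ℕ → X)) {ω | ε ≤ prokhorovDist (Z ω) (W ω)} ≤ ENNReal.ofReal ε := by
  obtain ⟨δ, ⟨-, hδ⟩, hδε⟩ := exists_lt_of_csInf_lt (s := {ε : ℝ | 0 ≤ ε ∧
    (seqLaw μ : Measure (ℕ → X)) {ω | ε < prokhorovDist (Z ω) (W ω)} ≤ ENNReal.ofReal ε})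
    -- The level `1` always qualifies, so the infimum is over a nonempty set.
    ⟨1, zero_le_one, by simpa using prob_le_one⟩ h
  exact (measure_mono fun ω hω => hδε.trans_le hω).trans
    (hδ.trans (ENNReal.ofReal_le_ofReal hδε.le))

end Perturbation

/-! ### Small balls in spaces that are not totally bounded -/

section TotallyBounded

variable {S : Type*} [PseudoMetricSpace S]

lemma exists_seq_separated_of_not_totallyBounded (h : ¬ TotallyBounded (Set.univ : Set S)) :
    ∃ r > 0, ∃ u : ℕ → S, ∀ i j, i ≠ j → 2 * r ≤ dist (u i) (u j) := by
  rw [Metric.totallyBounded_iff] at h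
  push Not at h
  obtain ⟨ε, hε, h⟩ := h
  obtain ⟨u, -, hu⟩ := exists_seq_of_forall_finset_exists (fun _ : S => True)
    (fun x y => ε ≤ dist x y) fun s _ => by
      obtain ⟨y, -, hy⟩ := Set.not_subset.1 (h s s.finite_toSet)
      refine ⟨y, trivial, fun x hx => ?_⟩
      simp only [Set.mem_iUnion, Metric.mem_ball, not_exists, not_lt] at hy
      rw [dist_comm]
      exact hy x hx
  refine ⟨ε / 2, half_pos hε, u, fun i j hij => ?_⟩
  rw [mul_div_cancel₀ _ two_ne_zero]
  rcases hij.lt_or_gt with hij | hij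
  · exact hu i j hij
  · exact dist_comm (u i) (u j) ▸ hu j i hij

/-- In a space which is not totally bounded, a probability measure gives arbitrarily small mass
to balls of a fixed radius. -/
lemma exists_measureReal_ball_lt_of_not_totallyBounded [MeasurableSpace S]
    [OpensMeasurableSpace S] (h : ¬ TotallyBounded (Set.univ : Set S))
    (μ : Measure S) [IsFiniteMeasure μ] :
    ∃ r > 0, ∀ δ > 0, ∃ x, μ.real (Metric.ball x r) < δ := by
  obtain ⟨r, hr, u, hu⟩ := exists_seq_separated_of_not_totallyBounded h
  refine ⟨r, hr, fun δ hδ => ?_⟩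
  -- Disjoint balls have summable masses, so the masses tend to zero while `r` stays fixed.
  have hdisj : Pairwise (Function.onFun Disjoint fun i => Metric.ball (u i) r) :=
    fun i j hij => Metric.ball_disjoint_ball (by linarith [hu i j hij])
  have hsum : ∑' i, μ (Metric.ball (u i) r) ≠ ∞ := by
    rw [← measure_iUnion hdisj fun i => Metric.isOpen_ball.measurableSet]
    exact measure_ne_top _ _
  have hlim := ENNReal.tendsto_atTop_zero_of_tsum_ne_top hsum
  obtain ⟨i, hi⟩ := (hlim.eventually (gt_mem_nhds (ENNReal.ofReal_pos.2 hδ))).exists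
  exact ⟨u i, (ENNReal.lt_ofReal_iff_toReal_lt (measure_ne_top _ _)).1 hi⟩

end TotallyBounded

/-! ### Consistency on balls and failure of robustness -/

section Robustness

variable {Θ X : Type*} [PseudoMetricSpace Θ] [MeasurableSpace Θ] [OpensMeasurableSpace Θ]
  [TopologicalSpace X] [MeasurableSpace X] [OpensMeasurableSpace X]

/-- Posterior consistency: for an injective, open, measurable model, the posterior concentrates,
in probability, on balls around the true parameter. -/
theorem tendsto_posterior_compl_ball {P : Θ → ProbabilityMeasure X} (hP_inj : Function.Injective P)
    (hP : Measurable P) (hP_open : IsOpenMap (Set.rangeFactorization P)) {π : ProbabilityMeasure Θ}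
    {post : ∀ n : ℕ, (Fin n → X) → ProbabilityMeasure Θ}
    (hpost : ∀ n, IsPosterior P π n (post n)) {θ₀ : Θ} (hπ : HasKLSupportAt P π θ₀)
    {r : ℝ} (hr : 0 < r) {c : ℝ} (hc : 0 < c) :
    Tendsto (fun n => (sampleLaw (P θ₀) n : Measure (Fin n → X)).real
      {x | c ≤ (post n x : Measure Θ).real (Metric.ball θ₀ r)ᶜ}) atTop (𝓝 0) := by
  obtain ⟨V, hV, hVeq⟩ := isOpen_induced_iff.1 (hP_open _ (Metric.isOpen_ball (x := θ₀) (ε := r)))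
  have hmem (θ : Θ) : P θ ∈ V ↔ θ ∈ Metric.ball θ₀ r := by
    change Set.rangeFactorization P θ ∈ Subtype.val ⁻¹' V ↔ _
    rw [hVeq, (Set.rangeFactorization_injective.2 hP_inj).mem_set_image]
  exact tendsto_sampleLaw_posterior_ge hP hpost hπ
    (isExpTestable_of_mem_nhds (hV.mem_nhds ((hmem θ₀).2 (Metric.mem_ball_self hr))))
    Metric.isOpen_ball.measurableSet.compl (fun θ hθ h => hθ ((hmem θ).1 h)) hc

/-- Posteriors of a prior that ignores a ball stay away from the posteriors of a prior which is
consistent at the center of the ball. -/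
lemma eventually_le_kyFanDist {P : Θ → ProbabilityMeasure X} (hP_inj : Function.Injective P)
    (hP : Measurable P) (hP_open : IsOpenMap (Set.rangeFactorization P)) (I : BayesianInference P)
    {π π' : ProbabilityMeasure Θ} {θ₀ : Θ} (hπ : HasKLSupportAt P π θ₀) {r : ℝ} (hr : 0 < r)
    (hπ' : (π' : Measure Θ) (Metric.ball θ₀ r) = 0) :
    ∀ᶠ n in atTop,
      min (1 / 4) (r / 2) ≤ kyFanDist (P θ₀) (I.posteriorSeq π n) (I.posteriorSeq π' n) := by
  -- The bound `r / 2` keeps the `ε`-thickening of the half-radius ball inside the null ball of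
  -- `π'`. The bound `1 / 4` puts `ε` below `1 / 2`, both for the posterior mass of the half-radius
  -- ball and for the probability of `Aᶜ`.
  set ε : ℝ := min (1 / 4) (r / 2)
  have hε1 : ε ≤ 1 / 4 := min_le_left _ _
  have hε2 : ε ≤ r / 2 := min_le_right _ _
  have hlim := tendsto_posterior_compl_ball hP_inj hP hP_open (fun n => I.isPosterior π n) hπ
    (half_pos hr) (show (0 : ℝ) < 1 / 2 by norm_num)
  filter_upwards [hlim.eventually (gt_mem_nhds (show (0 : ℝ) < 1 / 2 by norm_num))] with n hn
  by_contra! hlt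
  set A : Set (Fin n → X) := {x | 1 / 2 ≤ (I.post π n x : Measure Θ).real (Metric.ball θ₀ (r / 2))ᶜ}
  have hBm : MeasurableSet (Metric.ball θ₀ (r / 2)) := Metric.isOpen_ball.measurableSet
  have hA : MeasurableSet A :=
    measurableSet_le measurable_const ((I.isPosterior π n).measurable_real hBm.compl)
  have hsub : (fun (ω : ℕ → X) (i : Fin n) => ω i) ⁻¹' Aᶜ ⊆
      {ω | ε ≤ prokhorovDist (I.posteriorSeq π n ω) (I.posteriorSeq π' n ω)} := by
    intro ω hω
    rw [Set.mem_ofPred_eq]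
    by_contra! hd
    have h1 := measureReal_le_of_prokhorovDist_lt hd hBm
    have h2 : (I.posteriorSeq π' n ω : Measure Θ).real
        (Metric.thickening ε (Metric.ball θ₀ (r / 2))) = 0 := by
      rw [measureReal_eq_zero_iff]
      -- Absolute continuity holds at every sample, so the data marginal of `π'` need not be
      -- compared with the law of the data under `θ₀`.
      refine measure_mono_null ?_ ((I.isPosterior π' n).absolutelyContinuous _ hπ')
      refine (Metric.thickening_ball _ _ _).trans (Metric.ball_subset_ball ?_)
      linarith
    have h3 : (I.posteriorSeq π n ω : Measure Θ).real (Metric.ball θ₀ (r / 2))ᶜ < 1 / 2 :=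
      not_le.1 hω
    rw [probReal_compl_eq_one_sub hBm] at h3
    linarith
  have h4 := (measure_mono hsub).trans (seqLaw_le_of_kyFanDist_lt hlt)
  rw [← Measure.map_apply (by fun_prop) hA.compl, map_seqLaw, ← ofReal_measureReal,
    ENNReal.ofReal_le_ofReal_iff (by positivity), probReal_compl_eq_one_sub hA] at h4
  linarith

end Robustness

end BayesRobust

open BayesRobust in
/-- `Θ` and `X` are Borel subsets of Polish metric spaces `E` and `F`; spaces of probability
measures carry the weak topology. -/
theorem theorem4p2
    {E F : Type*}
    [MetricSpace E] [CompleteSpace E] [SecondCountableTopology E]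
    [MeasurableSpace E] [BorelSpace E]
    [MetricSpace F] [CompleteSpace F] [SecondCountableTopology F]
    [MeasurableSpace F] [BorelSpace F]
    (Θ : Set E) (hΘ : MeasurableSet Θ) (X : Set F) (hX : MeasurableSet X)
    (P : Θ → ProbabilityMeasure X)
    (hP_inj : Function.Injective P) (hP_meas : Measurable P) (hP_dom : IsDominated P)
    (hP_open : IsOpenMap (Set.rangeFactorization P))
    (I : BayesianInference P)
    (dX : ProbabilityMeasure X → ProbabilityMeasure X → ℝ) (hdX : IsPseudometric dX)
    (dM : ProbabilityMeasure (ProbabilityMeasure Θ) →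
      ProbabilityMeasure (ProbabilityMeasure Θ) → ℝ) (hdM : IsPseudometric dM)
    (hΘ_tb : ¬ TotallyBounded Θ)
    (π : ProbabilityMeasure Θ) (hπ : ∀ θ, HasKLSupportAt P π θ)
    (ρ : ℝ) (hρ : 0 < ρ) :
    ¬ QualitativelyRobust I tvDist dX dM kyFanDist (admissibleSet P π ρ) := by
  intro hrob
  have htb : ¬ TotallyBounded (Set.univ : Set Θ) := fun h => hΘ_tb <| by
    simpa using h.image uniformContinuous_subtype_val
  obtain ⟨r, hr, hball⟩ := exists_measureReal_ball_lt_of_not_totallyBounded htb (π : Measure Θ)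
  obtain ⟨δ₁, hδ₁, δ₂, hδ₂, h⟩ := hrob 1 one_pos (min (1 / 4) (r / 2)) (by positivity)
  -- Mass below `δ₁` meets the robustness tolerance, below `ρ` gives admissibility, and below `1`
  -- permits conditioning on the complement.
  obtain ⟨θ₀, hθ₀⟩ := hball (min δ₁ (min ρ 1)) (by positivity)
  rw [lt_min_iff, lt_min_iff] at hθ₀
  obtain ⟨hB₁, hBρ, hB1⟩ := hθ₀
  obtain ⟨π', hπ'0, hπ'⟩ :=
    exists_measure_eq_zero_tvDist_le π Metric.isOpen_ball.measurableSet hB1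
  have hrobust := h π (P θ₀) π' (P θ₀) ⟨rfl, hπ'.trans_lt hBρ, θ₀, rfl, rfl⟩
    (hπ'.trans_lt hB₁) (by rwa [hdX.self])
  obtain ⟨n, hn, hn'⟩ := (hrobust.and (eventually_le_kyFanDist hP_inj hP_meas hP_open I (hπ θ₀)
    hr hπ'0)).exists
  exact absurd hn.2 (not_lt.2 hn')
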